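/- Let $\mathcal H$ be a complex Hilbert space. A state is a positive trace class operator $\rho$ on $\mathcal H$ with $\mathrm{tr}[\rho]=1$, and $\langle X\rangle_\rho:=\mathrm{tr}[\rho X]$ for bounded $X$. For a compact self-adjoint operator $A$ with spectrum $\sigma(A)$ let $P_A(a)$ denote the orthogonal projection onto $\ker(A-a)$, and for a bounded self-adjoint operator $B$ let $P_B$ be its spectral measure. The joint probability of a sequential (Lüders) projective measurement of $A$ and then $B$ in the state $\rho$ is $$P_\rho^{A\to B}(a\to S):=\mathrm{tr}\bigl[P_A(a)\,\rho\,P_A(a)\,P_B(S)\bigr]\qquad(a\in\sigma(A),\ S\subseteq\mathbb R\ \text{Borel}),$$ and the operational correlation is $$\langle A\to B\rangle^{\mathrm{op}}_\rho:=\sum_{a\in\sigma(A)}a\int_{\mathbb R} b\;P_\rho^{A\to B}(a\to \mathrm db),$$ which is $\sum_{a,b}ab\,P_\rho^{A\to B}(a\to \{b\})$ when $B$ has finite spectrum. For an arbitrary bounded operator $B=B_1+iB_2$ with $B_1,B_2$ self-adjoint, put $\langle A\to B\rangle^{\mathrm{op}}_\rho:=\langle A\to B_1\rangle^{\mathrm{op}}_\rho+i\langle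 A\to B_2\rangle^{\mathrm{op}}_\rho$. Write $\{A,B\}=AB+BA$. **Theorem.** Let $A$ be a compact self-adjoint operator on $\mathcal H$ that is not of the form $\lambda I$ with $\lambda\in\mathbb R$. Then the following are equivalent: (i) for every bounded operator $B$ on $\mathcal H$ and every state $\rho$, $\langle A\to B\rangle^{\mathrm{op}}_\rho=\left\langle \tfrac{\{A,B\}}{2}\right\rangle_\rho$; (ii) for every bounded self-adjoint operator $B$ with $\sigma(B)=\{1,-1\}$ and every state $\rho$, $\langle A\to B\rangle^{\mathrm{op}}_\rho=\left\langle \tfrac{\{A,B\}}{2}\right\rangle_\rho$; (iii) there is $\alpha>0$ such that $\sigma(A)=\{\alpha,-\alpha\}$. -/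

import Mathlib

open scoped ComplexStarModule

namespace QuantumCorrelation

noncomputable section

variable {H : Type*} [NormedAddCommGroup H] [InnerProductSpace ℂ H] [CompleteSpace H]

/-! ### Trace, trace class operators and states -/

variable (H) in
/-- The index set of a fixed orthonormal basis of the Hilbert space `H`. -/
def basisIndex : Set H := Classical.choose (exists_hilbertBasis ℂ H)

variable (H) in
/-- A fixed orthonormal (Hilbert) basis of `H`.  The notions below do not depend on this choice. -/
def basis : HilbertBasis (basisIndex H) ℂ H :=
  Classical.choose (Classical.choose_spec (exists_hilbertBasis ℂ H))

/-- `T` is trace class: `∑ᵢ ⟨eᵢ, |T| eᵢ⟩ < ∞`, where `|T| = (T* T)^(1/2)`. -/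
def IsTraceClass (T : H →L[ℂ] H) : Prop :=
  Summable fun i => inner ℂ (basis H i) ((CFC.abs T) (basis H i))

/-- The trace `∑ᵢ ⟨eᵢ, T eᵢ⟩`; it is only used for trace class operators `T`. -/
def trace (T : H →L[ℂ] H) : ℂ :=
  ∑' i, inner ℂ (basis H i) (T (basis H i))

variable (H) in
/-- Density operators: positive trace class operators of trace one. -/
structure State where
  op : H →L[ℂ] H
  nonneg : 0 ≤ op
  traceClass : IsTraceClass op
  trace_eq_one : trace op = 1

/-- The expectation value `⟨X⟩_ρ = tr[ρ X]` of a bounded operator `X`. -/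
def State.expectation (ρ : State H) (X : H →L[ℂ] H) : ℂ := trace (ρ.op * X)

/-! ### Spectral projections -/

/-- The projection `P_A(a)` onto the eigenspace of `A` for `a`.  For a compact self-adjoint `A`
this is the spectral projection of `A` at the point `a` (it is `0` if `a` is not an eigenvalue). -/
def eigenProjection (A : H →L[ℂ] H) (a : ℝ) : H →L[ℂ] H :=
  (LinearMap.ker (A - (a : ℂ) • (1 : H →L[ℂ] H)).toLinearMap).starProjection

/-- The spectral family (resolution of the identity) of a bounded self-adjoint operator `B`:
`spectralFamily B b = P_B((-∞, b])` is the projection onto the kernel of the positive part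
`(B - b)⁺` of `B - b`.  The projection onto the eigenspace of `B` for `b` is its jump at `b`. -/
def spectralFamily (B : selfAdjoint (H →L[ℂ] H)) (b : ℝ) : H →L[ℂ] H :=
  (LinearMap.ker
    (cfc (fun x : ℝ => max (x - b) 0) (B : H →L[ℂ] H)).toLinearMap).starProjection

/-- The Lüders operation `ρ ↦ Π_A(a)(ρ) = P_A(a) ρ P_A(a)` for the outcome `a`. -/
def luders (A : H →L[ℂ] H) (a : ℝ) (ρ : State H) : H →L[ℂ] H :=
  eigenProjection A a * ρ.op * eigenProjection A a

/-- `jointCDF A B ρ a b = tr[Π_A(a)(ρ) P_B((-∞, b])]`: the probability that in a measurement of `A`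
followed by a measurement of `B`, the first outcome is `a` and the second one is at most `b`. -/
def jointCDF (A : H →L[ℂ] H) (B : selfAdjoint (H →L[ℂ] H)) (ρ : State H) (a b : ℝ) : ℝ :=
  (trace (luders A a ρ * spectralFamily B b)).re

/-! ### The joint distribution function is monotone in `b` -/

lemma hasSum_norm_inner_sq (x : H) :
    HasSum (fun j => ‖inner ℂ (basis H j) x‖ ^ 2) (‖x‖ ^ 2) := by
  have h0 := (basis H).hasSum_inner_mul_inner x x
  have h := Complex.hasSum_re h0
  have e : (inner ℂ x x : ℂ).re = ‖x‖ ^ 2 := by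
    rw [inner_self_eq_norm_sq_to_K]; norm_cast
  rw [e] at h
  have hf : (fun j => (inner ℂ x (basis H j) * inner ℂ (basis H j) x : ℂ).re)
      = fun j => ‖inner ℂ (basis H j) x‖ ^ 2 := by
    funext j
    rw [← inner_conj_symm x (basis H j), Complex.conj_mul']
    norm_cast
  rwa [hf] at h

lemma summable_prod_of_summable {S : H →L[ℂ] H} (hS : Summable fun i => ‖S (basis H i)‖ ^ 2) :
    Summable fun p : basisIndex H × basisIndex H =>
      ‖inner ℂ (basis H p.2) (S (basis H p.1))‖ ^ 2 := by
  rw [summable_prod_of_nonneg (fun _ => by positivity)]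
  refine ⟨fun i => (hasSum_norm_inner_sq (S (basis H i))).summable, hS.congr fun i => ?_⟩
  exact (hasSum_norm_inner_sq (S (basis H i))).tsum_eq.symm

lemma summable_adjoint {S : H →L[ℂ] H} (hS : Summable fun i => ‖S (basis H i)‖ ^ 2) :
    Summable fun i => ‖(star S) (basis H i)‖ ^ 2 := by
  have h := (summable_prod_of_summable hS).prod_symm
  rw [summable_prod_of_nonneg (fun _ => by positivity)] at h
  convert h.2 using 2 with i
  rw [← (hasSum_norm_inner_sq _).tsum_eq]
  refine tsum_congr fun j => ?_
  rw [ContinuousLinearMap.star_eq_adjoint, ContinuousLinearMap.adjoint_inner_right,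
    ← inner_conj_symm, RCLike.norm_conj]
  rfl

lemma summable_mul_left {S : H →L[ℂ] H} (X : H →L[ℂ] H)
    (hS : Summable fun i => ‖S (basis H i)‖ ^ 2) :
    Summable fun i => ‖(X * S) (basis H i)‖ ^ 2 := by
  refine Summable.of_nonneg_of_le (fun _ => by positivity) (fun i => ?_) (hS.mul_left (‖X‖ ^ 2))
  rw [← mul_pow]
  exact pow_le_pow_left₀ (norm_nonneg _) (X.le_opNorm _) 2

lemma summable_mul_right {S : H →L[ℂ] H} (X : H →L[ℂ] H)
    (hS : Summable fun i => ‖S (basis H i)‖ ^ 2) :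
    Summable fun i => ‖(S * X) (basis H i)‖ ^ 2 := by
  have h := summable_adjoint (summable_mul_left (star X) (summable_adjoint hS))
  simpa [star_mul] using h

lemma summable_inner {S T : H →L[ℂ] H} (hS : Summable fun i => ‖S (basis H i)‖ ^ 2)
    (hT : Summable fun i => ‖T (basis H i)‖ ^ 2) :
    Summable fun i => (inner ℂ (S (basis H i)) (T (basis H i)) : ℂ) := by
  refine Summable.of_norm_bounded (hS.add hT) fun i => ?_
  have h := norm_inner_le_norm (𝕜 := ℂ) (S (basis H i)) (T (basis H i))
  nlinarith [sq_nonneg (‖S (basis H i)‖ - ‖T (basis H i)‖), sq_nonneg ‖S (basis H i)‖,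
    sq_nonneg ‖T (basis H i)‖]

lemma tsum_inner_comm {S T : H →L[ℂ] H} (hS : Summable fun i => ‖S (basis H i)‖ ^ 2)
    (hT : Summable fun i => ‖T (basis H i)‖ ^ 2) :
    ∑' i, (inner ℂ (S (basis H i)) (T (basis H i)) : ℂ) =
      ∑' j, inner ℂ ((star T) (basis H j)) ((star S) (basis H j)) := by
  have hsum : Summable fun p : basisIndex H × basisIndex H =>
      (inner ℂ (S (basis H p.1)) (basis H p.2) * inner ℂ (basis H p.2) (T (basis H p.1)) : ℂ) := by
    refine Summable.of_norm_bounded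
      ((summable_prod_of_summable hS).add (summable_prod_of_summable hT)) fun p => ?_
    rw [norm_mul, ← inner_conj_symm (S (basis H p.1)) (basis H p.2), RCLike.norm_conj]
    nlinarith [sq_nonneg (‖(inner ℂ (basis H p.2) (S (basis H p.1)) : ℂ)‖
      - ‖(inner ℂ (basis H p.2) (T (basis H p.1)) : ℂ)‖),
      sq_nonneg ‖(inner ℂ (basis H p.2) (S (basis H p.1)) : ℂ)‖,
      sq_nonneg ‖(inner ℂ (basis H p.2) (T (basis H p.1)) : ℂ)‖]
  calc ∑' i, (inner ℂ (S (basis H i)) (T (basis H i)) : ℂ)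
      = ∑' i, ∑' j, (inner ℂ (S (basis H i)) (basis H j) *
          inner ℂ (basis H j) (T (basis H i)) : ℂ) :=
        tsum_congr fun i => ((basis H).tsum_inner_mul_inner _ _).symm
    _ = ∑' j, ∑' i, (inner ℂ (S (basis H i)) (basis H j) *
          inner ℂ (basis H j) (T (basis H i)) : ℂ) :=
        (Summable.tsum_comm (f := fun i j => (inner ℂ (S (basis H i)) (basis H j) *
          inner ℂ (basis H j) (T (basis H i)) : ℂ)) hsum).symm
    _ = _ := by
        refine tsum_congr fun j => ?_
        rw [← (basis H).tsum_inner_mul_inner]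
        refine tsum_congr fun i => ?_
        rw [ContinuousLinearMap.star_eq_adjoint, ContinuousLinearMap.star_eq_adjoint,
          ContinuousLinearMap.adjoint_inner_left, ContinuousLinearMap.adjoint_inner_right, mul_comm]

lemma State.summable_sqrt (ρ : State H) :
    Summable fun i => ‖(CFC.sqrt ρ.op) (basis H i)‖ ^ 2 := by
  have h := Complex.hasSum_re ρ.traceClass.hasSum
  rw [CFC.abs_of_nonneg ρ.op ρ.nonneg] at h
  refine h.summable.congr fun i => ?_
  have hs : ContinuousLinearMap.adjoint (CFC.sqrt ρ.op) = CFC.sqrt ρ.op :=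
    (CFC.sqrt_nonneg ρ.op).isSelfAdjoint.star_eq
  conv_lhs => rw [← CFC.sqrt_mul_sqrt_self ρ.op ρ.nonneg]
  rw [mul_apply_eq_comp, ← ContinuousLinearMap.adjoint_inner_left, hs,
    inner_self_eq_norm_sq_to_K]
  norm_cast

lemma eigenProjection_star (A : H →L[ℂ] H) (a : ℝ) :
    star (eigenProjection A a) = eigenProjection A a :=
  isSelfAdjoint_starProjection _

lemma luders_eq (A : H →L[ℂ] H) (a : ℝ) (ρ : State H) :
    luders A a ρ =
      star (CFC.sqrt ρ.op * eigenProjection A a) * (CFC.sqrt ρ.op * eigenProjection A a) := by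
  rw [star_mul, eigenProjection_star, (CFC.sqrt_nonneg ρ.op).isSelfAdjoint.star_eq, luders]
  conv_lhs => rw [← CFC.sqrt_mul_sqrt_self ρ.op ρ.nonneg]
  simp only [mul_assoc]

lemma inner_luders (A : H →L[ℂ] H) (a : ℝ) (ρ : State H) (X : H →L[ℂ] H) (x : H) :
    inner ℂ x ((luders A a ρ * X) x) = (inner ℂ ((CFC.sqrt ρ.op * eigenProjection A a) x)
      ((CFC.sqrt ρ.op * eigenProjection A a * X) x) : ℂ) := by
  rw [luders_eq, ContinuousLinearMap.star_eq_adjoint, mul_assoc, mul_apply_eq_comp,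
    ContinuousLinearMap.adjoint_inner_right]

lemma summable_luders (A : H →L[ℂ] H) (a : ℝ) (ρ : State H) (X : H →L[ℂ] H) :
    Summable fun i => (inner ℂ (basis H i) ((luders A a ρ * X) (basis H i)) : ℂ) := by
  simp only [inner_luders]
  have h := summable_mul_right (eigenProjection A a) ρ.summable_sqrt
  exact summable_inner h (summable_mul_right X h)

lemma trace_luders_nonneg (A : H →L[ℂ] H) (a : ℝ) (ρ : State H) {X : H →L[ℂ] H} (hX : 0 ≤ X) :
    0 ≤ (trace (luders A a ρ * X)).re := by
  have h := summable_mul_right (eigenProjection A a) ρ.summable_sqrt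
  have h' := summable_mul_right X h
  have hX' := (ContinuousLinearMap.nonneg_iff_isPositive X).1 hX
  have e : trace (luders A a ρ * X) = ∑' j, inner ℂ
      (X ((star (CFC.sqrt ρ.op * eigenProjection A a)) (basis H j)))
      ((star (CFC.sqrt ρ.op * eigenProjection A a)) (basis H j)) := by
    rw [trace]
    simp only [inner_luders]
    rw [tsum_inner_comm h h', star_mul, hX.isSelfAdjoint.star_eq]
    rfl
  have hs := (summable_inner (summable_adjoint h') (summable_adjoint h))
  rw [star_mul, hX.isSelfAdjoint.star_eq] at hs
  rw [e]
  refine le_of_le_of_eq ?_ (Complex.re_tsum hs).symm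
  exact tsum_nonneg fun j => hX'.re_inner_nonneg_left _

lemma spectralFamily_mono (B : selfAdjoint (H →L[ℂ] H)) : Monotone (spectralFamily B) := by
  intro b c hbc
  refine Submodule.starProjection_le_starProjection_iff.2 fun x hx => ?_
  have hc : ∀ d : ℝ, ContinuousOn (fun x : ℝ => max (x - d) 0) (spectrum ℝ (B : H →L[ℂ] H)) :=
    fun d => by fun_prop
  have h0 : ∀ d : ℝ, 0 ≤ cfc (fun x : ℝ => max (x - d) 0) (B : H →L[ℂ] H) :=
    fun d => cfc_nonneg fun x _ => le_max_right _ _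
  have hle : cfc (fun x : ℝ => max (x - c) 0) (B : H →L[ℂ] H)
      ≤ cfc (fun x : ℝ => max (x - b) 0) (B : H →L[ℂ] H) :=
    cfc_mono (fun x _ => max_le_max (by linarith) le_rfl) (hc c) (hc b)
  set S := cfc (fun x : ℝ => max (x - b) 0) (B : H →L[ℂ] H) with hS
  set T := cfc (fun x : ℝ => max (x - c) 0) (B : H →L[ℂ] H) with hT
  have hSx : S x = 0 := hx
  have h1 := ((ContinuousLinearMap.le_def T S).1 hle).re_inner_nonneg_left x
  have h2 : (inner ℂ (T x) x : ℂ).re = ‖CFC.sqrt T x‖ ^ 2 := by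
    have hs : ContinuousLinearMap.adjoint (CFC.sqrt T) = CFC.sqrt T :=
      (CFC.sqrt_nonneg T).isSelfAdjoint.star_eq
    have ht : T x = CFC.sqrt T (CFC.sqrt T x) := by
      conv_lhs => rw [← CFC.sqrt_mul_sqrt_self T (h0 c)]
      rfl
    rw [ht, ← ContinuousLinearMap.adjoint_inner_right, hs, inner_self_eq_norm_sq_to_K]
    norm_cast
  have h3 : (inner ℂ ((S - T) x) x : ℂ).re = -‖CFC.sqrt T x‖ ^ 2 := by
    rw [← h2, sub_apply, hSx, zero_sub, inner_neg_left, Complex.neg_re]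
  have h4 : 0 ≤ -‖CFC.sqrt T x‖ ^ 2 := h3 ▸ h1
  have h5 : CFC.sqrt T x = 0 := by
    have : ‖CFC.sqrt T x‖ = 0 := by nlinarith [norm_nonneg (CFC.sqrt T x)]
    exact norm_eq_zero.1 this
  have h6 : T x = 0 := by
    conv_lhs => rw [← CFC.sqrt_mul_sqrt_self T (h0 c)]
    change CFC.sqrt T (CFC.sqrt T x) = 0
    rw [h5, map_zero]
  exact h6

lemma jointCDF_mono (A : H →L[ℂ] H) (B : selfAdjoint (H →L[ℂ] H)) (ρ : State H) (a : ℝ) :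
    Monotone (jointCDF A B ρ a) := by
  intro b c hbc
  have h := trace_luders_nonneg A a ρ (sub_nonneg.2 (spectralFamily_mono B hbc))
  have e : trace (luders A a ρ * (spectralFamily B c - spectralFamily B b)) =
      trace (luders A a ρ * spectralFamily B c) - trace (luders A a ρ * spectralFamily B b) := by
    simp only [trace]
    rw [← (summable_luders A a ρ _).tsum_sub (summable_luders A a ρ _)]
    exact tsum_congr fun i => by simp [mul_sub]
  rw [e, Complex.sub_re] at h
  exact sub_nonneg.1 h

/-! ### Operational correlations -/

/-- The joint law `P_ρ^{A→B}(a → ·)` as a measure in the second outcome, i.e. the measure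
`S ↦ tr[Π_A(a)(ρ) P_B(S)]` on `ℝ`: the Lebesgue-Stieltjes measure of `jointCDF A B ρ a`. -/
def jointLaw (A : H →L[ℂ] H) (B : selfAdjoint (H →L[ℂ] H)) (ρ : State H) (a : ℝ) :
    MeasureTheory.Measure ℝ :=
  (jointCDF_mono A B ρ a).stieltjesFunction.measure

/-- The operational correlation `⟨A → B⟩_ρ^op = ∑_{a,b} a b P_ρ^{A→B}(a → b)` of a compact
self-adjoint `A` and a bounded self-adjoint `B`; the sum over the outcomes `b` of `B` is the integral
against the joint law, since the spectrum of `B` need not be discrete. -/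
def opCorrelationSA (A : H →L[ℂ] H) (B : selfAdjoint (H →L[ℂ] H)) (ρ : State H) : ℝ :=
  ∑' a : spectrum ℝ A, (a : ℝ) * ∫ b, b ∂(jointLaw A B ρ a)

/-- The operational correlation `⟨A → B⟩_ρ^op` for an arbitrary bounded operator `B`: the complex
linear extension from self-adjoint operators, through `B = Re B + i Im B`. -/
def opCorrelation (A B : H →L[ℂ] H) (ρ : State H) : ℂ :=
  (opCorrelationSA A (ℜ B) ρ : ℂ) + Complex.I * (opCorrelationSA A (ℑ B) ρ : ℂ)

/-- The symmetrized product `{A, B} / 2`. -/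
def symmProduct (A B : H →L[ℂ] H) : H →L[ℂ] H := (1 / 2 : ℂ) • (A * B + B * A)

end

end QuantumCorrelation

namespace QuantumCorrelation
noncomputable section
variable {H : Type*} [NormedAddCommGroup H] [InnerProductSpace ℂ H] [CompleteSpace H]

/-! ### Expectation values -/

/-! The mean of the second outcome, given the first outcome `a`, is tr[P_A(a) ρ P_A(a) B]
(`integral_jointLaw`). By cyclicity of the trace (`trace_luders_mul`) the operational correlation is
therefore ∑ a ⟨P_A(a) B P_A(a)⟩_ρ: measuring `A` removes the blocks of `B` that connect different
eigenspaces of `A`, whereas {A,B}/2 multiplies the block between the eigenvalues `a` and `b` by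
(a+b)/2. The two agree for all `B` exactly when a + b = 0 for any two distinct eigenvalues.

For necessity, take unit eigenvectors x, y with eigenvalues a ≠ b, the reflection exchanging x and
y, and the normalized state along x + y. The operational correlation vanishes and the symmetrized
one is (a+b)/2, so b = -a (`add_eq_zero_of_opCorrelation_eq`). A non-scalar compact self-adjoint `A`
has two distinct eigenvalues, which are then ±a, and no others, so A² = a². For sufficiency, both
spectral projections are affine in `A`, and α(P₊BP₊ - P₋BP₋) = {A,B}/2 is an algebraic identity.

The analytic work lies in the mean. It avoids a projection-valued integral by comparing the
stop-loss functions c ↦ tr[Π (B-c)⁺] and c ↦ ∫ (b-c)⁺ dμ: their increments obey the same two-sided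
bounds in terms of the distribution function (`le_shiftedPosPart_sub`, `shiftedPosPart_sub_le`), and
such bounds determine the increments (`sub_eq_sub_of_antitone_bounds`). -/

lemma State.adjoint_sqrt (ρ : State H) :
    ContinuousLinearMap.adjoint (CFC.sqrt ρ.op) = CFC.sqrt ρ.op :=
  (CFC.sqrt_nonneg ρ.op).isSelfAdjoint.star_eq

lemma State.summable_expectation (ρ : State H) (X : H →L[ℂ] H) :
    Summable fun i => (inner ℂ (CFC.sqrt ρ.op (basis H i))
      (X (CFC.sqrt ρ.op (basis H i))) : ℂ) := by
  have h := summable_inner ρ.summable_sqrt (summable_mul_left X ρ.summable_sqrt)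
  simp only [mul_apply_eq_comp] at h
  exact h

/-- Cyclicity of the trace, with √ρ Hilbert–Schmidt. In this symmetric form the series converges for
every bounded `X`, and linearity and reality can be checked termwise. -/
lemma State.expectation_eq (ρ : State H) (X : H →L[ℂ] H) :
    ρ.expectation X = ∑' i, (inner ℂ (CFC.sqrt ρ.op (basis H i))
      (X (CFC.sqrt ρ.op (basis H i))) : ℂ) := by
  have h1 : ρ.expectation X = ∑' i, (inner ℂ (CFC.sqrt ρ.op (basis H i))
      ((CFC.sqrt ρ.op * X) (basis H i)) : ℂ) := by
    rw [State.expectation, trace]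
    refine tsum_congr fun i => ?_
    conv_lhs => rw [← CFC.sqrt_mul_sqrt_self ρ.op ρ.nonneg]
    rw [mul_assoc, mul_apply_eq_comp, ← ContinuousLinearMap.adjoint_inner_left, ρ.adjoint_sqrt]
  rw [h1, tsum_inner_comm ρ.summable_sqrt (summable_mul_right X ρ.summable_sqrt)]
  refine tsum_congr fun i => ?_
  rw [star_mul, mul_apply_eq_comp, ContinuousLinearMap.star_eq_adjoint,
    ContinuousLinearMap.star_eq_adjoint, ρ.adjoint_sqrt, ContinuousLinearMap.adjoint_inner_left]

/-- Passage from the Schrödinger to the Heisenberg picture: the Lüders operation is moved from the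
state to the observable. -/
lemma trace_luders_mul (A : H →L[ℂ] H) (a : ℝ) (ρ : State H) (X : H →L[ℂ] H) :
    trace (luders A a ρ * X) =
      ρ.expectation (eigenProjection A a * X * eigenProjection A a) := by
  have h := summable_mul_right (eigenProjection A a) ρ.summable_sqrt
  rw [trace, State.expectation_eq]
  simp only [inner_luders]
  rw [tsum_inner_comm h (summable_mul_right X h)]
  refine tsum_congr fun i => ?_
  have hP := eigenProjection_star A a
  rw [ContinuousLinearMap.star_eq_adjoint] at hP
  simp only [star_mul, mul_apply_eq_comp, ContinuousLinearMap.star_eq_adjoint, ρ.adjoint_sqrt, hP,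
    ContinuousLinearMap.adjoint_inner_left]
  rw [← ContinuousLinearMap.adjoint_inner_left (eigenProjection A a), hP]

lemma State.expectation_add (ρ : State H) (X Y : H →L[ℂ] H) :
    ρ.expectation (X + Y) = ρ.expectation X + ρ.expectation Y := by
  simp only [State.expectation_eq]
  rw [← (ρ.summable_expectation X).tsum_add (ρ.summable_expectation Y)]
  exact tsum_congr fun i => by rw [add_apply, inner_add_right]

lemma State.expectation_smul (ρ : State H) (c : ℂ) (X : H →L[ℂ] H) :
    ρ.expectation (c • X) = c * ρ.expectation X := by
  simp only [State.expectation_eq]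
  rw [← tsum_mul_left]
  exact tsum_congr fun i => by rw [smul_apply, inner_smul_right]

lemma State.expectation_sub (ρ : State H) (X Y : H →L[ℂ] H) :
    ρ.expectation (X - Y) = ρ.expectation X - ρ.expectation Y := by
  have h := ρ.expectation_add (X - Y) Y
  rw [sub_add_cancel] at h
  rw [h, add_sub_cancel_right]

lemma State.conj_expectation (ρ : State H) {X : H →L[ℂ] H} (hX : IsSelfAdjoint X) :
    (starRingEnd ℂ) (ρ.expectation X) = ρ.expectation X := by
  rw [State.expectation_eq, Complex.conj_tsum]
  refine tsum_congr fun i => ?_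
  rw [inner_conj_symm]
  exact hX.isSymmetric _ _

/-! ### Eigenprojections -/

lemma eigenProjection_apply_of_eq {A : H →L[ℂ] H} {a : ℝ} {x : H} (hx : A x = (a : ℂ) • x) :
    eigenProjection A a x = x :=
  Submodule.starProjection_eq_self_iff.2 (by simp [hx])

lemma inner_eq_zero_of_eigenvectors {A : H →L[ℂ] H} (hA : IsSelfAdjoint A) {a b : ℝ} (hab : a ≠ b)
    {x y : H} (hx : A x = (a : ℂ) • x) (hy : A y = (b : ℂ) • y) : inner ℂ x y = 0 := by
  have h : inner ℂ (A x) y = inner ℂ x (A y) := hA.isSymmetric x y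
  rw [hx, hy, inner_smul_left, inner_smul_right, Complex.conj_ofReal, ← sub_eq_zero, ← sub_mul,
    mul_eq_zero] at h
  refine h.resolve_left fun h => hab ?_
  exact_mod_cast sub_eq_zero.1 h

lemma eigenProjection_apply_of_ne {A : H →L[ℂ] H} (hA : IsSelfAdjoint A) {a b : ℝ} (hab : a ≠ b)
    {x : H} (hx : A x = (a : ℂ) • x) : eigenProjection A b x = 0 := by
  refine (Submodule.starProjection_apply_eq_zero_iff _).2 fun y hy => ?_
  refine inner_eq_zero_of_eigenvectors hA hab.symm ?_ hx
  simpa [sub_eq_zero] using hy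

/-- The eigenvectors of a compact self-adjoint operator span a dense subspace, and the kernel of S -
T is closed. This is the only form in which the spectral theorem for `A` is used. -/
lemma eq_of_eq_on_eigenvectors {A : H →L[ℂ] H} (hA : IsSelfAdjoint A) (hAc : IsCompactOperator A)
    {S T : H →L[ℂ] H} (h : ∀ (a : ℝ) (x : H), A x = (a : ℂ) • x → S x = T x) : S = T := by
  have hs : (⨆ μ, Module.End.eigenspace (A : Module.End ℂ H) μ) ≤
      LinearMap.ker (S - T).toLinearMap := by
    refine iSup_le fun μ x hx => ?_
    by_cases h0 : x = 0
    · simp [h0]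
    have hx' : A x = μ • x := by simpa using hx
    -- Eigenvalues are real, so the hypothesis on real `a` covers every complex eigenspace.
    have hμ : (starRingEnd ℂ) μ = μ := hA.isSymmetric.conj_eigenvalue_eq_self
      (Module.End.hasEigenvalue_of_hasEigenvector ⟨hx, h0⟩)
    have := h μ.re x (by rw [Complex.conj_eq_iff_re.1 hμ, hx'])
    simpa [sub_eq_zero] using this
  have hb : (LinearMap.ker (S - T).toLinearMap)ᗮ = ⊥ := by
    refine le_bot_iff.1 ((Submodule.orthogonal_le hs).trans_eq ?_)
    exact ContinuousLinearMap.orthogonalComplement_iSup_eigenspaces_eq_bot hAc hA.isSymmetric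
  have : IsClosed ((LinearMap.ker (S - T).toLinearMap : Submodule ℂ H) : Set H) :=
    (S - T).isClosed_ker
  have : CompleteSpace (LinearMap.ker (S - T).toLinearMap) := this.completeSpace_coe
  have ht := Submodule.orthogonal_eq_bot_iff.1 hb
  ext x
  have hx : x ∈ LinearMap.ker (S - T).toLinearMap := ht ▸ Submodule.mem_top
  simpa [sub_eq_zero] using hx

/-! ### Spectra of operators whose square is a scalar -/

omit [CompleteSpace H] in
lemma mem_spectrum_of_eigenvector {T : H →L[ℂ] H} {d : ℂ} {z : H} (hz : z ≠ 0)
    (h : T z = d • z) : d ∈ spectrum ℂ T := by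
  rw [spectrum.mem_iff]
  rintro ⟨u, hu⟩
  have h1 : (↑u⁻¹ * (u : H →L[ℂ] H)) z = 0 := by
    rw [mul_apply_eq_comp, hu]
    simp [h, Algebra.algebraMap_eq_smul_one]
  rw [u.inv_mul] at h1
  exact hz h1

omit [CompleteSpace H] in
/-- An operator squaring to `c²` that has eigenvectors for `c` and for `-c` has spectrum `{c, -c}`. -/
lemma spectrum_eq_pair {T : H →L[ℂ] H} {c : ℂ} (hT : T * T = c ^ 2 • 1) {x y : H} (hx0 : x ≠ 0)
    (hy0 : y ≠ 0) (hx : T x = c • x) (hy : T y = -c • y) : spectrum ℂ T = {c, -c} := by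
  ext d
  simp only [Set.mem_insert_iff, Set.mem_singleton_iff]
  constructor
  · intro hd
    by_contra hne
    rw [not_or] at hne
    have hne' : d ^ 2 - c ^ 2 ≠ 0 := by
      rw [sq_sub_sq]
      exact mul_ne_zero (fun h => hne.2 (eq_neg_of_add_eq_zero_left h)) (sub_ne_zero.2 hne.1)
    have e1 : (algebraMap ℂ (H →L[ℂ] H) d - T) * (algebraMap ℂ (H →L[ℂ] H) d + T) =
        (d ^ 2 - c ^ 2) • 1 := by
      simp only [Algebra.algebraMap_eq_smul_one, sub_mul, mul_add, hT]
      simp only [smul_mul_assoc, one_mul, mul_smul_comm, mul_one, sub_smul, pow_two, mul_smul]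
      abel
    have e2 : (algebraMap ℂ (H →L[ℂ] H) d + T) * (algebraMap ℂ (H →L[ℂ] H) d - T) =
        (d ^ 2 - c ^ 2) • 1 := by
      simp only [Algebra.algebraMap_eq_smul_one, add_mul, mul_sub, hT]
      simp only [smul_mul_assoc, one_mul, mul_smul_comm, mul_one, sub_smul, pow_two, mul_smul]
      abel
    -- Since T² = c², the inverse of d - T is (d + T)/(d² - c²).
    refine (spectrum.mem_iff.1 hd) ⟨⟨_, (d ^ 2 - c ^ 2)⁻¹ • (algebraMap ℂ (H →L[ℂ] H) d + T),
      ?_, ?_⟩, rfl⟩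
    · rw [mul_smul_comm, e1, inv_smul_smul₀ hne']
    · rw [smul_mul_assoc, e2, inv_smul_smul₀ hne']
  · rintro (rfl | rfl)
    · exact mem_spectrum_of_eigenvector hx0 hx
    · exact mem_spectrum_of_eigenvector hy0 hy

/-! ### The mean of the joint law -/

/-- Both increments lie between the lower and upper Riemann sums of `u`. On a uniform mesh of n + 1
steps these sums differ by (d-c)(u c - u d)/(n+1), which tends to 0. -/
lemma sub_eq_sub_of_antitone_bounds {G g u : ℝ → ℝ}
    (hG : ∀ c d, c ≤ d → (d - c) * u d ≤ G c - G d ∧ G c - G d ≤ (d - c) * u c)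
    (hg : ∀ c d, c ≤ d → (d - c) * u d ≤ g c - g d ∧ g c - g d ≤ (d - c) * u c)
    {c d : ℝ} (hcd : c ≤ d) : G c - G d = g c - g d := by
  -- The error on one mesh interval is at most `h` times the drop of `u` there; the drops telescope.
  have step : ∀ h : ℝ, 0 ≤ h → ∀ k : ℕ,
      |(G c - G (c + k * h)) - (g c - g (c + k * h))| ≤ h * (u c - u (c + k * h)) := by
    intro h hh k
    induction k with
    | zero => simp
    | succ k ih =>
      have e : c + (k + 1 : ℕ) * h = c + k * h + h := by push_cast; ring
      have h1 := hG (c + k * h) (c + k * h + h) (by linarith)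
      have h2 := hg (c + k * h) (c + k * h + h) (by linarith)
      rw [add_sub_cancel_left] at h1 h2
      rw [e]
      rw [abs_le] at ih ⊢
      constructor <;> linarith [ih.1, ih.2, h1.1, h1.2, h2.1, h2.2]
  have bound : ∀ n : ℕ, (n + 1 : ℝ) * |(G c - G d) - (g c - g d)| ≤ (d - c) * (u c - u d) := by
    intro n
    have hn : (0 : ℝ) < n + 1 := by positivity
    have h := step ((d - c) / (n + 1)) (div_nonneg (by linarith) hn.le) (n + 1)
    have e : c + (n + 1 : ℕ) * ((d - c) / (n + 1)) = d := by
      push_cast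
      rw [mul_div_cancel₀ _ hn.ne']
      ring
    rw [e] at h
    calc _ ≤ (n + 1 : ℝ) * ((d - c) / (n + 1) * (u c - u d)) := by gcongr
      _ = _ := by field_simp
  by_contra hne
  have hpos : 0 < |(G c - G d) - (g c - g d)| := abs_pos.2 (sub_ne_zero.2 hne)
  obtain ⟨n, hn⟩ := exists_nat_gt ((d - c) * (u c - u d) / |(G c - G d) - (g c - g d)|)
  rw [div_lt_iff₀ hpos] at hn
  linarith [bound n]

/-- The order gives ‖√S x‖² = ⟨Sx, x⟩ ≤ ⟨Tx, x⟩ = 0. -/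
lemma apply_eq_zero_of_le {S T : H →L[ℂ] H} (hS : 0 ≤ S) (hST : S ≤ T) {x : H} (hx : T x = 0) :
    S x = 0 := by
  have h1 := ((ContinuousLinearMap.le_def S T).1 hST).re_inner_nonneg_left x
  have hs : ContinuousLinearMap.adjoint (CFC.sqrt S) = CFC.sqrt S :=
    (CFC.sqrt_nonneg S).isSelfAdjoint.star_eq
  have hSx : S x = CFC.sqrt S (CFC.sqrt S x) := by
    conv_lhs => rw [← CFC.sqrt_mul_sqrt_self S hS]
    rfl
  rw [sub_apply, hx, zero_sub, inner_neg_left, hSx,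
    ← ContinuousLinearMap.adjoint_inner_right, hs, inner_self_eq_norm_sq_to_K] at h1
  have h2 : 0 ≤ -‖CFC.sqrt S x‖ ^ 2 := by
    convert h1 using 1
    rw [map_neg]
    norm_cast
  have h3 : CFC.sqrt S x = 0 := norm_eq_zero.1 (by nlinarith [norm_nonneg (CFC.sqrt S x)])
  rw [hSx, h3, map_zero]

/-- The positive part `(B - c)⁺`. -/
def shiftedPosPart (B : selfAdjoint (H →L[ℂ] H)) (c : ℝ) : H →L[ℂ] H :=
  cfc (fun x : ℝ => max (x - c) 0) (B : H →L[ℂ] H)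

lemma spectralFamily_star (B : selfAdjoint (H →L[ℂ] H)) (b : ℝ) :
    star (spectralFamily B b) = spectralFamily B b :=
  isSelfAdjoint_starProjection _

lemma spectralFamily_mul_self (B : selfAdjoint (H →L[ℂ] H)) (b : ℝ) :
    spectralFamily B b * spectralFamily B b = spectralFamily B b :=
  Submodule.isIdempotentElem_starProjection _

lemma shiftedPosPart_sub (B : selfAdjoint (H →L[ℂ] H)) (c d : ℝ) :
    shiftedPosPart B c - shiftedPosPart B d =
      cfc (fun x : ℝ => max (x - c) 0 - max (x - d) 0) (B : H →L[ℂ] H) :=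
  (cfc_sub _ _ _ (by fun_prop) (by fun_prop)).symm

/-- With D the difference of positive parts and E = P_B((-∞, d]), the operator D - (d-c) is
annihilated by (B-d)⁺, so it lives on the range of E. Hence D - (d-c)(1-E) = EDE ≥ 0. -/
lemma le_shiftedPosPart_sub (B : selfAdjoint (H →L[ℂ] H)) {c d : ℝ} (hcd : c ≤ d) :
    ((d - c : ℝ) : ℂ) • (1 - spectralFamily B d) ≤ shiftedPosPart B c - shiftedPosPart B d := by
  set E := spectralFamily B d with hE
  set D := shiftedPosPart B c - shiftedPosPart B d with hD
  have hDs : IsSelfAdjoint D := by rw [hD, shiftedPosPart_sub]; exact cfc_predicate _ _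
  have hD0 : 0 ≤ D := by
    rw [hD, shiftedPosPart_sub]
    exact cfc_nonneg fun x _ => sub_nonneg.2 (max_le_max (by linarith) le_rfl)
  -- Where (x-d)⁺ is nonzero, the difference (x-c)⁺ - (x-d)⁺ equals d - c.
  have h1 : shiftedPosPart B d * D = ((d - c : ℝ) : ℂ) • shiftedPosPart B d := by
    have e : ((d - c : ℝ) : ℂ) • shiftedPosPart B d = (d - c : ℝ) • shiftedPosPart B d := rfl
    rw [e, hD, shiftedPosPart_sub, shiftedPosPart, ← cfc_mul _ _ _ (by fun_prop) (by fun_prop),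
      ← cfc_smul _ _ _ (by fun_prop)]
    refine cfc_congr fun x _ => ?_
    simp only [smul_eq_mul]
    rcases le_total x d with h | h
    · rw [max_eq_right (sub_nonpos.2 h)]; ring
    · rw [max_eq_left (sub_nonneg.2 h), max_eq_left (by linarith)]; ring
  set K := D - ((d - c : ℝ) : ℂ) • (1 : H →L[ℂ] H) with hK
  have hKs : star K = K := by
    rw [hK, star_sub, hDs.star_eq, star_smul, star_one, Complex.star_def, Complex.conj_ofReal]
  have hEK : E * K = K := by
    ext x
    refine Submodule.starProjection_eq_self_iff.2 ?_
    rw [LinearMap.mem_ker]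
    have h2 : shiftedPosPart B d * K = 0 := by
      rw [hK, mul_sub, h1, mul_smul_comm, mul_one, sub_self]
    exact congrArg (fun T : H →L[ℂ] H => T x) h2
  have hKE : K * E = K := by
    have h := congrArg star hEK
    rwa [star_mul, hKs, hE, spectralFamily_star] at h
  have hEE : E * E = E := spectralFamily_mul_self B d
  have e : D - ((d - c : ℝ) : ℂ) • (1 - E) = star E * D * E := by
    rw [hE, spectralFamily_star, ← hE]
    have hDK : D = K + ((d - c : ℝ) : ℂ) • (1 : H →L[ℂ] H) := by rw [hK, sub_add_cancel]
    rw [hDK, mul_add, hEK, add_mul, hKE, mul_smul_comm, mul_one, smul_mul_assoc, hEE, smul_sub]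
    abel
  rw [← sub_nonneg, e]
  exact star_left_conjugate_nonneg hD0 E

/-- From 0 ≤ D ≤ (B-c)⁺, D vanishes on the range of E = P_B((-∞, c]). Compressing D ≤ d - c by 1 - E
then gives the bound. -/
lemma shiftedPosPart_sub_le (B : selfAdjoint (H →L[ℂ] H)) {c d : ℝ} (hcd : c ≤ d) :
    shiftedPosPart B c - shiftedPosPart B d ≤ ((d - c : ℝ) : ℂ) • (1 - spectralFamily B c) := by
  set E := spectralFamily B c with hE
  set D := shiftedPosPart B c - shiftedPosPart B d with hD
  have hDs : IsSelfAdjoint D := by rw [hD, shiftedPosPart_sub]; exact cfc_predicate _ _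
  have hD0 : 0 ≤ D := by
    rw [hD, shiftedPosPart_sub]
    exact cfc_nonneg fun x _ => sub_nonneg.2 (max_le_max (by linarith) le_rfl)
  have hD1 : D ≤ shiftedPosPart B c :=
    sub_le_self _ (cfc_nonneg fun x _ => le_max_right _ _)
  have hD2 : 0 ≤ ((d - c : ℝ) : ℂ) • (1 : H →L[ℂ] H) - D := by
    have e : ((d - c : ℝ) : ℂ) • (1 : H →L[ℂ] H) = algebraMap ℝ (H →L[ℂ] H) (d - c) := by
      rw [Algebra.algebraMap_eq_smul_one]; rfl
    rw [sub_nonneg, e, hD, shiftedPosPart_sub]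
    refine cfc_le_algebraMap _ _ _ (fun x _ => ?_) (by fun_prop) B.2
    rcases le_total x c with h | h
    · rw [max_eq_right (sub_nonpos.2 h), max_eq_right (by linarith)]; linarith
    · rw [max_eq_left (sub_nonneg.2 h)]
      linarith [le_max_left (x - d) 0]
  have hDE : D * E = 0 := by
    ext x
    refine apply_eq_zero_of_le hD0 hD1 ?_
    exact Submodule.starProjection_apply_mem (LinearMap.ker (shiftedPosPart B c).toLinearMap) x
  have hED : E * D = 0 := by
    have h := congrArg star hDE
    rwa [star_mul, hDs.star_eq, hE, spectralFamily_star, star_zero] at h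
  have hEE : E * E = E := spectralFamily_mul_self B c
  have e : ((d - c : ℝ) : ℂ) • (1 - E) - D =
      star (1 - E) * (((d - c : ℝ) : ℂ) • (1 : H →L[ℂ] H) - D) * (1 - E) := by
    rw [star_sub, star_one, hE, spectralFamily_star, ← hE]
    simp only [sub_mul, mul_sub, one_mul, mul_one, hED, hDE, hEE, mul_smul_comm, smul_mul_assoc,
      smul_sub, sub_zero, sub_self]
  rw [← sub_nonneg, e]
  exact star_left_conjugate_nonneg hD2 (1 - E)

lemma abs_le_norm_of_mem_spectrum (B : H →L[ℂ] H) {x : ℝ} (hx : x ∈ spectrum ℝ B) : |x| ≤ ‖B‖ := by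
  have h := spectrum.norm_le_norm_mul_of_mem hx
  refine h.trans ?_
  calc ‖B‖ * ‖(1 : H →L[ℂ] H)‖ ≤ ‖B‖ * 1 := by
        gcongr; exact ContinuousLinearMap.norm_id_le
    _ = ‖B‖ := mul_one _

lemma shiftedPosPart_of_le (B : selfAdjoint (H →L[ℂ] H)) {c : ℝ} (hc : c ≤ -‖(B : H →L[ℂ] H)‖) :
    shiftedPosPart B c = B - (c : ℂ) • (1 : H →L[ℂ] H) := by
  have e : (c : ℂ) • (1 : H →L[ℂ] H) = algebraMap ℝ (H →L[ℂ] H) c := by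
    rw [Algebra.algebraMap_eq_smul_one]; rfl
  have h : shiftedPosPart B c = cfc (fun x : ℝ => x - c) (B : H →L[ℂ] H) :=
    cfc_congr fun x hx => max_eq_left (by
      linarith [neg_abs_le x, abs_le_norm_of_mem_spectrum (B : H →L[ℂ] H) hx])
  rw [h, e, cfc_sub _ _ _ (by fun_prop) (by fun_prop), 
    cfc_id' ℝ (B : H →L[ℂ] H) (show IsSelfAdjoint (B : H →L[ℂ] H) from B.2),
    cfc_const c (B : H →L[ℂ] H) (show IsSelfAdjoint (B : H →L[ℂ] H) from B.2)]

lemma shiftedPosPart_of_ge (B : selfAdjoint (H →L[ℂ] H)) {c : ℝ} (hc : ‖(B : H →L[ℂ] H)‖ ≤ c) :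
    shiftedPosPart B c = 0 := by
  have h : shiftedPosPart B c = cfc (fun _ : ℝ => (0 : ℝ)) (B : H →L[ℂ] H) :=
    cfc_congr fun x hx => max_eq_right (by
      linarith [le_abs_self x, abs_le_norm_of_mem_spectrum (B : H →L[ℂ] H) hx])
  rw [h, cfc_const_zero]

/-- A Lebesgue–Stieltjes measure whose distribution function increases from `0` to `T` inside
`[-M, M]` has mean determined by the bounds on its stop-loss transform. -/
lemma integral_id_stieltjes {F G : ℝ → ℝ} (hF : Monotone F) {T M : ℝ}
    (hbot : ∀ x, x < -M → F x = 0) (htop : ∀ x, M < x → F x = T)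
    (hG : ∀ c d, c ≤ d → (d - c) * (T - F d) ≤ G c - G d ∧ G c - G d ≤ (d - c) * (T - F c)) :
    ∀ N, M < N → 0 ≤ N → ∫ b, b ∂hF.stieltjesFunction.measure = G (-N) - G N - N * T := by
  intro N hMN hN
  set f := hF.stieltjesFunction with hf
  have hfle : ∀ x, F x ≤ f x := fun x => hF.le_rightLim le_rfl
  have hfge : ∀ x y, x < y → f x ≤ F y := fun x y h => hF.rightLim_le h
  have hfbot : ∀ x, x < -M → f x = 0 := by
    intro x hx
    obtain ⟨y, hy1, hy2⟩ := exists_between hx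
    refine le_antisymm ((hfge x y hy1).trans_eq (hbot y hy2)) ?_
    rw [← hbot x hx]
    exact hfle x
  have hftop : ∀ x, M < x → f x = T := by
    intro x hx
    refine le_antisymm ((hfge x (x + 1) (by linarith)).trans_eq (htop _ (by linarith))) ?_
    rw [← htop x hx]
    exact hfle x
  have tbot : Filter.Tendsto f Filter.atBot (nhds 0) :=
    tendsto_const_nhds.congr' ((Filter.eventually_lt_atBot (-M)).mono fun x hx => (hfbot x hx).symm)
  have ttop : Filter.Tendsto f Filter.atTop (nhds T) :=
    tendsto_const_nhds.congr' ((Filter.eventually_gt_atTop M).mono fun x hx => (hftop x hx).symm)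
  have hfT : ∀ x, f x ≤ T := fun x => f.mono.ge_of_tendsto ttop x
  have hf0 : ∀ x, 0 ≤ f x := fun x => f.mono.le_of_tendsto tbot x
  have hT : 0 ≤ T := (hf0 0).trans (hfT 0)
  set μ := f.measure with hμ
  have huniv : μ Set.univ = ENNReal.ofReal T := by rw [hμ, f.measure_univ tbot ttop, sub_zero]
  have : MeasureTheory.IsFiniteMeasure μ := ⟨by rw [huniv]; exact ENNReal.ofReal_lt_top⟩
  have hr_univ : μ.real Set.univ = T := by
    rw [MeasureTheory.measureReal_def, huniv, ENNReal.toReal_ofReal hT]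
  have hr_Ioi : ∀ d, μ.real (Set.Ioi d) = T - f d := by
    intro d
    rw [MeasureTheory.measureReal_def, hμ, f.measure_Ioi ttop,
      ENNReal.toReal_ofReal (sub_nonneg.2 (hfT d))]
  have hae : ∀ᵐ b ∂μ, -N < b ∧ b ≤ N := by
    have h1 : μ (Set.Iic (-N)) = 0 := by
      rw [hμ, f.measure_Iic tbot, hfbot _ (by linarith), sub_zero, ENNReal.ofReal_zero]
    have h2 : μ (Set.Ioi N) = 0 := by
      rw [hμ, f.measure_Ioi ttop, hftop _ hMN, sub_self, ENNReal.ofReal_zero]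
    rw [MeasureTheory.ae_iff]
    refine MeasureTheory.measure_mono_null (fun b hb => ?_) (MeasureTheory.measure_union_null h1 h2)
    simp only [Set.mem_ofPred_eq, not_and_or, not_lt, not_le] at hb
    exact hb
  have hid : MeasureTheory.Integrable (fun b : ℝ => b) μ :=
    MeasureTheory.Integrable.of_bound (by fun_prop) N
      (hae.mono fun b hb => abs_le.2 ⟨hb.1.le, hb.2⟩)
  have hint : ∀ c : ℝ, MeasureTheory.Integrable (fun b : ℝ => max (b - c) 0) μ :=
    fun c => (hid.sub (MeasureTheory.integrable_const c)).pos_part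
  have hind : ∀ r c : ℝ, MeasureTheory.Integrable ((Set.Ioi c).indicator fun _ => r) μ :=
    fun r c => (MeasureTheory.integrable_const r).indicator measurableSet_Ioi
  have hindi : ∀ r c : ℝ, ∫ b, (Set.Ioi c).indicator (fun _ => r) b ∂μ = r * (T - f c) := by
    intro r c
    rw [MeasureTheory.integral_indicator measurableSet_Ioi, MeasureTheory.setIntegral_const,
      hr_Ioi, smul_eq_mul, mul_comm]
  -- Pointwise, (b-c)⁺ - (b-d)⁺ lies between d - c times the indicators of (d, ∞) and (c, ∞).
  have hg : ∀ c d, c ≤ d →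
      (d - c) * (T - f d) ≤ (∫ b, max (b - c) 0 ∂μ) - ∫ b, max (b - d) 0 ∂μ ∧
      (∫ b, max (b - c) 0 ∂μ) - ∫ b, max (b - d) 0 ∂μ ≤ (d - c) * (T - f c) := by
    intro c d hcd
    rw [← MeasureTheory.integral_sub (hint c) (hint d), ← hindi, ← hindi]
    constructor
    · refine MeasureTheory.integral_mono (hind _ _) ((hint c).sub (hint d)) fun b => ?_
      simp only [Set.indicator_apply, Set.mem_Ioi]
      split_ifs with h
      · rw [max_eq_left (by linarith), max_eq_left (by linarith)]; linarith
      · exact sub_nonneg.2 (max_le_max (by linarith) le_rfl)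
    · refine MeasureTheory.integral_mono ((hint c).sub (hint d)) (hind _ _) fun b => ?_
      simp only [Set.indicator_apply, Set.mem_Ioi]
      split_ifs with h
      · rw [max_eq_left (by linarith)]
        linarith [le_max_left (b - d) 0]
      · rw [max_eq_right (by linarith), max_eq_right (by linarith)]; linarith
  -- The measure sees the right limit `f` of `F`. The lower bound only weakens because F ≤ f; for
  -- the upper bound, split [c, d] at s and let s decrease to c.
  have hG' : ∀ c d, c ≤ d →
      (d - c) * (T - f d) ≤ G c - G d ∧ G c - G d ≤ (d - c) * (T - f c) := by
    intro c d hcd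
    refine ⟨le_trans (mul_le_mul_of_nonneg_left (by linarith [hfle d]) (by linarith))
      (hG c d hcd).1, ?_⟩
    rcases hcd.eq_or_lt with rfl | hlt
    · simp
    have t1 : Filter.Tendsto (fun s => (s - c) * (T - F c) + (d - s) * (T - F s))
        (nhdsWithin c (Set.Ioi c)) (nhds ((c - c) * (T - F c) + (d - c) * (T - f c))) := by
      have tc : Filter.Tendsto (fun s : ℝ => s) (nhdsWithin c (Set.Ioi c)) (nhds c) :=
        Filter.tendsto_id.mono_left nhdsWithin_le_nhds
      exact ((tc.sub_const c).mul_const _).add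
        ((tc.const_sub d).mul ((hF.tendsto_rightLim c).const_sub T))
    rw [sub_self, zero_mul, zero_add] at t1
    refine ge_of_tendsto t1 ?_
    filter_upwards [Ioo_mem_nhdsGT hlt] with s hs
    linarith [(hG c s hs.1.le).2, (hG s d hs.2.le).2]
  have hmain := sub_eq_sub_of_antitone_bounds hG' hg (by linarith : -N ≤ N)
  have g1 : ∫ b, max (b - -N) 0 ∂μ = (∫ b, b ∂μ) + N * T := by
    rw [MeasureTheory.integral_congr_ae (g := fun b => b + N)
      (hae.mono fun b hb => by dsimp only; rw [max_eq_left (by linarith [hb.1])]; ring),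
      MeasureTheory.integral_add hid (MeasureTheory.integrable_const N),
      MeasureTheory.integral_const, hr_univ, smul_eq_mul, mul_comm T]
  have g2 : ∫ b, max (b - N) 0 ∂μ = 0 := by
    rw [MeasureTheory.integral_congr_ae (g := fun _ => (0 : ℝ))
      (hae.mono fun b hb => by dsimp only; rw [max_eq_right (by linarith [hb.2])])]
    simp
  rw [g1, g2] at hmain
  linarith

lemma trace_luders_mono (A : H →L[ℂ] H) (a : ℝ) (ρ : State H) {X Y : H →L[ℂ] H} (h : X ≤ Y) :
    (trace (luders A a ρ * X)).re ≤ (trace (luders A a ρ * Y)).re := by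
  have h := trace_luders_nonneg A a ρ (sub_nonneg.2 h)
  rw [trace_luders_mul] at h ⊢
  rw [trace_luders_mul, ← sub_nonneg, ← Complex.sub_re, ← State.expectation_sub, ← sub_mul,
    ← mul_sub]
  exact h

lemma re_trace_luders_sub (A : H →L[ℂ] H) (a : ℝ) (ρ : State H) (X Y : H →L[ℂ] H) :
    (trace (luders A a ρ * (X - Y))).re =
      (trace (luders A a ρ * X)).re - (trace (luders A a ρ * Y)).re := by
  simp only [trace_luders_mul]
  rw [← Complex.sub_re, ← State.expectation_sub, ← sub_mul, ← mul_sub]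

lemma re_trace_luders_smul (A : H →L[ℂ] H) (a : ℝ) (ρ : State H) (r : ℝ) (X : H →L[ℂ] H) :
    (trace (luders A a ρ * ((r : ℂ) • X))).re = r * (trace (luders A a ρ * X)).re := by
  simp only [trace_luders_mul]
  rw [mul_smul_comm, smul_mul_assoc, State.expectation_smul, Complex.re_ofReal_mul]

/-- The mean of the second outcome under the joint law is `tr[Π_A(a)(ρ) B]`. -/
theorem integral_jointLaw (A : H →L[ℂ] H) (B : selfAdjoint (H →L[ℂ] H)) (ρ : State H) (a : ℝ) :
    ∫ b, b ∂(jointLaw A B ρ a) = (trace (luders A a ρ * (B : H →L[ℂ] H))).re := by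
  set T := (trace (luders A a ρ * 1)).re with hT
  set M := ‖(B : H →L[ℂ] H)‖ with hM
  have hG : ∀ c d, c ≤ d → (d - c) * (T - jointCDF A B ρ a d) ≤
        (trace (luders A a ρ * shiftedPosPart B c)).re -
          (trace (luders A a ρ * shiftedPosPart B d)).re ∧
      (trace (luders A a ρ * shiftedPosPart B c)).re -
        (trace (luders A a ρ * shiftedPosPart B d)).re ≤ (d - c) * (T - jointCDF A B ρ a c) := by
    intro c d hcd
    rw [← re_trace_luders_sub, jointCDF, jointCDF, hT, ← re_trace_luders_sub,
      ← re_trace_luders_sub, ← re_trace_luders_smul, ← re_trace_luders_smul]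
    exact ⟨trace_luders_mono A a ρ (le_shiftedPosPart_sub B hcd),
      trace_luders_mono A a ρ (shiftedPosPart_sub_le B hcd)⟩
  have hlow : ∀ c, c ≤ -M → (trace (luders A a ρ * shiftedPosPart B c)).re =
      (trace (luders A a ρ * (B : H →L[ℂ] H))).re - c * T := by
    intro c hc
    rw [shiftedPosPart_of_le B hc, re_trace_luders_sub, re_trace_luders_smul]
  have hhigh : ∀ c, M ≤ c → (trace (luders A a ρ * shiftedPosPart B c)).re = 0 := by
    intro c hc
    rw [shiftedPosPart_of_ge B hc, mul_zero]
    simp [trace]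
  -- Below -M the stop-loss function is affine with slope -T, which the upper bound allows only if
  -- the distribution function is at most 0 there. Above M it is zero, and the lower bound likewise
  -- forces the value T.
  have hbot : ∀ x, x < -M → jointCDF A B ρ a x = 0 := by
    intro x hx
    refine le_antisymm ?_ (trace_luders_nonneg A a ρ ?_)
    · have h := (hG x (-M) hx.le).2
      rw [hlow _ hx.le, hlow _ le_rfl] at h
      have h' : (-M - x) * T ≤ (-M - x) * (T - jointCDF A B ρ a x) := by linarith
      linarith [le_of_mul_le_mul_left h' (by linarith)]
    · exact (ContinuousLinearMap.nonneg_iff_isPositive _).2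
        (ContinuousLinearMap.IsPositive.of_isStarProjection isStarProjection_starProjection)
  have htop : ∀ x, M < x → jointCDF A B ρ a x = T := by
    intro x hx
    refine le_antisymm (trace_luders_mono A a ρ ?_) ?_
    · exact (isStarProjection_starProjection).le_one
    · have h := (hG M x hx.le).1
      rw [hhigh _ le_rfl, hhigh _ hx.le, sub_self] at h
      have h' : (x - M) * (T - jointCDF A B ρ a x) ≤ (x - M) * 0 := by linarith
      linarith [le_of_mul_le_mul_left h' (by linarith)]
  have h0 : 0 ≤ M := norm_nonneg _
  rw [jointLaw, integral_id_stieltjes (jointCDF_mono A B ρ a) hbot htop hG (M + 1) (by linarith)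
    (by linarith), hlow _ (by linarith), hhigh _ (by linarith)]
  ring

lemma opCorrelationSA_eq_tsum (A : H →L[ℂ] H) (B : selfAdjoint (H →L[ℂ] H)) (ρ : State H) :
    opCorrelationSA A B ρ = ∑' a : spectrum ℝ A,
      (a : ℝ) * (ρ.expectation (eigenProjection A a * B * eigenProjection A a)).re := by
  simp only [opCorrelationSA, integral_jointLaw, trace_luders_mul]

/-! ### Correlations with self-adjoint operators -/

lemma opCorrelation_of_isSelfAdjoint (A : H →L[ℂ] H) {B : H →L[ℂ] H} (hB : IsSelfAdjoint B)
    (ρ : State H) : opCorrelation A B ρ = opCorrelationSA A ⟨B, hB⟩ ρ := by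
  have h0 : opCorrelationSA A 0 ρ = 0 := by
    simp [opCorrelationSA_eq_tsum, State.expectation_eq]
  have h1 : ℜ B = ⟨B, hB⟩ := Subtype.ext hB.coe_realPart
  rw [opCorrelation, hB.imaginaryPart, h0, h1, Complex.ofReal_zero, mul_zero, add_zero]

lemma isSelfAdjoint_symmProduct {A B : H →L[ℂ] H} (hA : IsSelfAdjoint A) (hB : IsSelfAdjoint B) :
    IsSelfAdjoint (symmProduct A B) := by
  rw [isSelfAdjoint_iff, symmProduct, star_smul, star_add, star_mul, star_mul, hA.star_eq,
    hB.star_eq, add_comm]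
  simp

/-! ### Necessity: vector states and swap reflections -/

/-- The vector state of a unit vector. -/
def vectorState (x : H) (hx : ‖x‖ = 1) : State H where
  op := InnerProductSpace.rankOne ℂ x x
  nonneg := (ContinuousLinearMap.nonneg_iff_isPositive _).2
    (InnerProductSpace.isPositive_rankOne_self x)
  traceClass := by
    rw [IsTraceClass, CFC.abs_of_nonneg _ ((ContinuousLinearMap.nonneg_iff_isPositive _).2
      (InnerProductSpace.isPositive_rankOne_self x))]
    refine ((basis H).summable_inner_mul_inner x x).congr fun i => ?_
    rw [InnerProductSpace.rankOne_apply, inner_smul_right]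
  trace_eq_one := by
    rw [trace]
    simp only [InnerProductSpace.rankOne_apply, inner_smul_right]
    rw [(basis H).tsum_inner_mul_inner, inner_self_eq_norm_sq_to_K, hx]
    simp

lemma expectation_vectorState (x : H) (hx : ‖x‖ = 1) (X : H →L[ℂ] H) :
    (vectorState x hx).expectation X = inner ℂ x (X x) := by
  rw [State.expectation, trace, ← ContinuousLinearMap.adjoint_inner_left,
    ← (basis H).tsum_inner_mul_inner]
  refine tsum_congr fun i => ?_
  rw [vectorState, mul_apply_eq_comp, InnerProductSpace.rankOne_apply, inner_smul_right,
    ContinuousLinearMap.adjoint_inner_left]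

/-- The reflection exchanging two orthogonal unit vectors. -/
def swapReflection (x y : H) : H →L[ℂ] H := 1 - InnerProductSpace.rankOne ℂ (x - y) (x - y)

lemma isSelfAdjoint_swapReflection (x y : H) : IsSelfAdjoint (swapReflection x y) :=
  (IsSelfAdjoint.one _).sub (InnerProductSpace.isPositive_rankOne_self _).isSelfAdjoint

omit [CompleteSpace H] in
lemma swapReflection_left {x y : H} (hx : ‖x‖ = 1) (hxy : inner ℂ x y = 0) :
    swapReflection x y x = y := by
  have hyx : inner ℂ y x = 0 := inner_eq_zero_symm.1 hxy
  simp [swapReflection, hyx, inner_self_eq_norm_sq_to_K, hx]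

omit [CompleteSpace H] in
lemma swapReflection_right {x y : H} (hy : ‖y‖ = 1) (hxy : inner ℂ x y = 0) :
    swapReflection x y y = x := by
  simp [swapReflection, hxy, inner_self_eq_norm_sq_to_K, hy]

omit [CompleteSpace H] in
lemma spectrum_swapReflection {x y : H} (hx : ‖x‖ = 1) (hy : ‖y‖ = 1) (hxy : inner ℂ x y = 0) :
    spectrum ℂ (swapReflection x y) = {1, -1} := by
  have hyx : inner ℂ y x = 0 := inner_eq_zero_symm.1 hxy
  have hne : x ≠ y := by
    rintro rfl
    rw [inner_self_eq_zero] at hxy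
    simp [hxy] at hx
  have hne' : x ≠ -y := by
    rintro rfl
    rw [inner_neg_left, neg_eq_zero, inner_self_eq_zero] at hxy
    simp [hxy] at hy
  have hw : inner ℂ (x - y) (x - y) = (2 : ℂ) := by
    rw [inner_sub_left, inner_sub_right, inner_sub_right, hxy, hyx, inner_self_eq_norm_sq_to_K,
      inner_self_eq_norm_sq_to_K, hx, hy]
    norm_num
  -- The reflection fixes x + y and negates x - y; it squares to 1 because ‖x - y‖² = 2.
  refine spectrum_eq_pair (c := 1) (x := x + y) (y := x - y) ?_ ?_ (sub_ne_zero.2 hne) ?_ ?_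
  · ext z
    simp only [swapReflection, mul_apply_eq_comp, sub_apply, one_apply_eq_self,
      InnerProductSpace.rankOne_apply, inner_sub_right (x - y) z, inner_smul_right, hw, one_pow,
      one_smul]
    module
  · exact fun h => hne' (eq_neg_of_add_eq_zero_left h)
  · rw [map_add, swapReflection_left hx hxy, swapReflection_right hy hxy, one_smul, add_comm]
  · rw [map_sub, swapReflection_left hx hxy, swapReflection_right hy hxy, neg_one_smul, neg_sub]

/-- Each eigenprojection of `A` sends x + y to x, y or 0, and the reflection takes x and y to
vectors orthogonal to them, so every term of the sum vanishes. -/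
lemma opCorrelation_swapReflection {A : H →L[ℂ] H} (hA : IsSelfAdjoint A) {a b : ℝ} (hab : a ≠ b)
    {x y : H} (hx : ‖x‖ = 1) (hy : ‖y‖ = 1) (hax : A x = (a : ℂ) • x) (hby : A y = (b : ℂ) • y)
    (r : ℂ) (h : ‖r • (x + y)‖ = 1) :
    opCorrelation A (swapReflection x y) (vectorState (r • (x + y)) h) = 0 := by
  have hxy : inner ℂ x y = 0 := inner_eq_zero_of_eigenvectors hA hab hax hby
  have hyx : inner ℂ y x = 0 := inner_eq_zero_symm.1 hxy
  rw [opCorrelation_of_isSelfAdjoint A (isSelfAdjoint_swapReflection x y), opCorrelationSA_eq_tsum]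
  rw [Complex.ofReal_eq_zero]
  refine (tsum_congr fun c => ?_).trans tsum_zero
  have hP := eigenProjection_star A c
  rw [ContinuousLinearMap.star_eq_adjoint] at hP
  rw [expectation_vectorState, mul_apply_eq_comp, mul_apply_eq_comp,
    ← ContinuousLinearMap.adjoint_inner_left, hP, map_smul, map_add]
  by_cases hca : a = c
  · rw [← hca, eigenProjection_apply_of_eq hax, eigenProjection_apply_of_ne hA hab.symm hby]
    simp [swapReflection_left hx hxy, inner_smul_left, inner_smul_right, hxy]
  · rw [eigenProjection_apply_of_ne hA hca hax, zero_add]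
    by_cases hcb : b = c
    · rw [← hcb, eigenProjection_apply_of_eq hby]
      simp [swapReflection_right hy hxy, inner_smul_left, inner_smul_right, hyx]
    · rw [eigenProjection_apply_of_ne hA hcb hby]
      simp

/-- The reflection fixes the state vector, so the symmetrized correlation is just the mean of `A` in
it. -/
lemma expectation_symmProduct_swapReflection {A : H →L[ℂ] H} (hA : IsSelfAdjoint A) {a b : ℝ}
    (hab : a ≠ b) {x y : H} (hx : ‖x‖ = 1) (hy : ‖y‖ = 1) (hax : A x = (a : ℂ) • x)
    (hby : A y = (b : ℂ) • y) (r : ℂ) (h : ‖r • (x + y)‖ = 1) :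
    (vectorState (r • (x + y)) h).expectation (symmProduct A (swapReflection x y)) =
      (starRingEnd ℂ) r * r * (a + b) := by
  have hxy : inner ℂ x y = 0 := inner_eq_zero_of_eigenvectors hA hab hax hby
  have hyx : inner ℂ y x = 0 := inner_eq_zero_symm.1 hxy
  rw [expectation_vectorState, symmProduct]
  simp only [smul_apply, add_apply, mul_apply_eq_comp, map_smul, map_add,
    swapReflection_left hx hxy, swapReflection_right hy hxy, hax, hby, inner_smul_left,
    inner_smul_right, inner_add_left, inner_add_right, hxy, hyx, inner_self_eq_norm_sq_to_K, hx, hy]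
  norm_num
  ring

lemma add_eq_zero_of_opCorrelation_eq {A : H →L[ℂ] H} (hA : IsSelfAdjoint A)
    (hop : ∀ B : H →L[ℂ] H, IsSelfAdjoint B → spectrum ℂ B = {1, -1} → ∀ ρ : State H,
      opCorrelation A B ρ = ρ.expectation (symmProduct A B))
    {a b : ℝ} (hab : a ≠ b) {x y : H} (hx : x ≠ 0) (hy : y ≠ 0) (hax : A x = (a : ℂ) • x)
    (hby : A y = (b : ℂ) • y) : a + b = 0 := by
  have norm_case : ∀ {x y : H}, ‖x‖ = 1 → ‖y‖ = 1 → A x = (a : ℂ) • x → A y = (b : ℂ) • y →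
      a + b = 0 := by
    intro x y hx hy hax hby
    have hxy : inner ℂ x y = 0 := inner_eq_zero_of_eigenvectors hA hab hax hby
    have hne : x + y ≠ 0 := by
      intro h0
      rw [eq_neg_of_add_eq_zero_left h0, inner_neg_left, neg_eq_zero, inner_self_eq_zero] at hxy
      simp [hxy] at hy
    have hr : ((‖x + y‖⁻¹ : ℝ) : ℂ) ≠ 0 := by simpa using hne
    have h1 : ‖((‖x + y‖⁻¹ : ℝ) : ℂ) • (x + y)‖ = 1 := by
      rw [norm_smul, Complex.norm_real, norm_inv, norm_norm,
        inv_mul_cancel₀ (norm_ne_zero_iff.2 hne)]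
    have h2 := hop _ (isSelfAdjoint_swapReflection x y) (spectrum_swapReflection hx hy hxy)
      (vectorState _ h1)
    rw [opCorrelation_swapReflection hA hab hx hy hax hby,
      expectation_symmProduct_swapReflection hA hab hx hy hax hby, Complex.conj_ofReal] at h2
    have h3 := (mul_eq_zero.1 h2.symm).resolve_left (mul_ne_zero hr hr)
    exact_mod_cast h3
  have hnorm : ∀ {z : H}, z ≠ 0 → ‖((‖z‖⁻¹ : ℝ) : ℂ) • z‖ = 1 := by
    intro z hz
    rw [norm_smul, Complex.norm_real, norm_inv, norm_norm, inv_mul_cancel₀ (norm_ne_zero_iff.2 hz)]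
  refine norm_case (hnorm hx) (hnorm hy) ?_ ?_
  · rw [map_smul, hax, smul_comm]
  · rw [map_smul, hby, smul_comm]

lemma spectrum_eq_pair_of_opCorrelation_eq {A : H →L[ℂ] H} (hA : IsSelfAdjoint A)
    (hAc : IsCompactOperator A) (hA' : ∀ c : ℝ, A ≠ (c : ℂ) • (1 : H →L[ℂ] H))
    (hop : ∀ B : H →L[ℂ] H, IsSelfAdjoint B → spectrum ℂ B = {1, -1} → ∀ ρ : State H,
      opCorrelation A B ρ = ρ.expectation (symmProduct A B)) :
    ∃ α : ℝ, 0 < α ∧ spectrum ℂ A = {(α : ℂ), -(α : ℂ)} := by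
  have hex : ∀ c : ℝ, ∃ (a : ℝ) (x : H), x ≠ 0 ∧ A x = (a : ℂ) • x ∧ a ≠ c := by
    intro c
    by_contra! hcon
    refine hA' c (eq_of_eq_on_eigenvectors hA hAc fun a x hx => ?_)
    by_cases h0 : x = 0
    · simp [h0]
    · rw [hx, hcon a x h0 hx, smul_apply, one_apply_eq_self]
  -- The value 0 is arbitrary: only the existence of an eigenvector is kept.
  obtain ⟨a, x, hx0, hax, -⟩ := hex 0
  obtain ⟨b, y, hy0, hby, hba⟩ := hex a
  have hb : b = -a :=
    eq_neg_of_add_eq_zero_left (add_eq_zero_of_opCorrelation_eq hA hop hba hy0 hx0 hby hax)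
  have ha0 : a ≠ 0 := fun h => hba (by rw [hb, h, neg_zero])
  have hsq : A * A = (a : ℂ) ^ 2 • (1 : H →L[ℂ] H) := by
    refine eq_of_eq_on_eigenvectors hA hAc fun c z hz => ?_
    by_cases hz0 : z = 0
    · simp [hz0]
    have hc : c = a ∨ c = -a := or_iff_not_imp_left.2 fun hca =>
      eq_neg_of_add_eq_zero_left (add_eq_zero_of_opCorrelation_eq hA hop hca hz0 hx0 hz hax)
    rw [mul_apply_eq_comp, hz, map_smul, hz, smul_apply, one_apply_eq_self, smul_smul]
    rcases hc with rfl | rfl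
    · rw [pow_two]
    · congr 1
      push_cast
      ring
  rw [hb, Complex.ofReal_neg] at hby
  have hs := spectrum_eq_pair hsq hx0 hy0 hax hby
  -- The eigenvalue `a` found first may be the negative one.
  refine ⟨|a|, abs_pos.2 ha0, ?_⟩
  rcases abs_choice a with h | h
  · rw [h, hs]
  · rw [h, hs, Complex.ofReal_neg, neg_neg, Set.pair_comm]

/-! ### Sufficiency: spectrum {α, -α} -/

lemma eigenProjection_eq_of_spectrum_eq_pair {A : H →L[ℂ] H} (hA : IsSelfAdjoint A)
    (hAc : IsCompactOperator A) {α : ℝ} (hα : α ≠ 0)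
    (hs : spectrum ℂ A = {(α : ℂ), -(α : ℂ)}) :
    eigenProjection A α = (2 * α : ℂ)⁻¹ • (A + (α : ℂ) • 1) := by
  have hα' : (2 * α : ℂ) ≠ 0 := mul_ne_zero two_ne_zero (by exact_mod_cast hα)
  refine eq_of_eq_on_eigenvectors hA hAc fun c z hz => ?_
  by_cases hz0 : z = 0
  · simp [hz0]
  have hc : (c : ℂ) ∈ spectrum ℂ A := mem_spectrum_of_eigenvector hz0 hz
  rw [hs, Set.mem_insert_iff, Set.mem_singleton_iff] at hc
  rw [smul_apply, add_apply, hz, smul_apply, one_apply_eq_self, ← add_smul, smul_smul]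
  rcases hc with hc | hc
  · rw [hc, ← two_mul, inv_mul_cancel₀ hα', one_smul]
    exact eigenProjection_apply_of_eq (by rw [hz, hc])
  · have hne : c ≠ α := by
      rintro rfl
      exact hα (by exact_mod_cast self_eq_neg.1 hc)
    rw [hc, neg_add_cancel, mul_zero, zero_smul]
    exact eigenProjection_apply_of_ne hA hne hz

/-- The sum over outcomes has just two terms, and the operator identity `hop` matches them with
{A,B}/2. The complex equality follows from that of real parts, as {A,B}/2 is self-adjoint. -/
lemma opCorrelationSA_eq_of_spectrum_eq_pair {A : H →L[ℂ] H} (hA : IsSelfAdjoint A)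
    (hAc : IsCompactOperator A) {α : ℝ} (hα : α ≠ 0)
    (hs : spectrum ℂ A = {(α : ℂ), -(α : ℂ)}) (B : selfAdjoint (H →L[ℂ] H)) (ρ : State H) :
    (opCorrelationSA A B ρ : ℂ) = ρ.expectation (symmProduct A B) := by
  have hα' : (2 * α : ℂ) ≠ 0 := mul_ne_zero two_ne_zero (by exact_mod_cast hα)
  have hsr : spectrum ℝ A = (({α, -α} : Finset ℝ) : Set ℝ) := by
    ext c
    rw [← spectrum.algebraMap_mem_iff ℂ, hs]
    simp only [Complex.coe_algebraMap, Set.mem_insert_iff, Set.mem_singleton_iff,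
      Finset.coe_insert, Finset.coe_singleton]
    norm_cast
  have hP := eigenProjection_eq_of_spectrum_eq_pair hA hAc hα hs
  have hN := eigenProjection_eq_of_spectrum_eq_pair hA hAc (neg_ne_zero.2 hα)
    (by rw [hs, Complex.ofReal_neg, neg_neg, Set.pair_comm])
  -- With P± = (α ± A)/(2α), the terms ABA and α²B cancel in the difference and only the mixed terms
  -- survive.
  have hop : symmProduct A (B : H →L[ℂ] H) =
      (α : ℂ) • (eigenProjection A α * B * eigenProjection A α) -
        (α : ℂ) • (eigenProjection A (-α) * B * eigenProjection A (-α)) := by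
    rw [hP, hN, symmProduct]
    push_cast
    simp only [mul_add, add_mul, smul_mul_assoc, mul_smul_comm, one_mul, mul_one, smul_add,
      smul_smul]
    have hα0 : (α : ℂ) ≠ 0 := by exact_mod_cast hα
    match_scalars <;> field_simp <;> norm_num
  have hre : opCorrelationSA A B ρ = (ρ.expectation (symmProduct A B)).re := by
    have hne : α ≠ -α := fun h => hα (self_eq_neg.1 h)
    rw [opCorrelationSA_eq_tsum, hsr, Finset.tsum_subtype' {α, -α} fun a : ℝ =>
      a * (ρ.expectation (eigenProjection A a * B * eigenProjection A a)).re,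
      Finset.sum_pair hne, hop, State.expectation_sub, State.expectation_smul,
      State.expectation_smul, Complex.sub_re, Complex.re_ofReal_mul, Complex.re_ofReal_mul]
    ring
  rw [hre]
  exact Complex.conj_eq_iff_re.1 (ρ.conj_expectation (isSelfAdjoint_symmProduct hA B.2))

lemma opCorrelation_eq_of_spectrum_eq_pair {A : H →L[ℂ] H} (hA : IsSelfAdjoint A)
    (hAc : IsCompactOperator A) {α : ℝ} (hα : α ≠ 0)
    (hs : spectrum ℂ A = {(α : ℂ), -(α : ℂ)}) (B : H →L[ℂ] H) (ρ : State H) :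
    opCorrelation A B ρ = ρ.expectation (symmProduct A B) := by
  rw [opCorrelation, opCorrelationSA_eq_of_spectrum_eq_pair hA hAc hα hs,
    opCorrelationSA_eq_of_spectrum_eq_pair hA hAc hα hs, ← State.expectation_smul,
    ← State.expectation_add]
  congr 1
  conv_rhs => rw [← realPart_add_I_smul_imaginaryPart B]
  simp only [symmProduct, mul_add, add_mul, mul_smul_comm, smul_mul_assoc]
  module

end

end QuantumCorrelation

theorem mainTheorem1 {H : Type*} [NormedAddCommGroup H] [InnerProductSpace ℂ H] [CompleteSpace H]
    (A : H →L[ℂ] H) (hA : IsSelfAdjoint A) (hAc : IsCompactOperator A)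
    (hA' : ∀ c : ℝ, A ≠ (c : ℂ) • (1 : H →L[ℂ] H)) :
    List.TFAE [
      ∀ B : H →L[ℂ] H, ∀ ρ : QuantumCorrelation.State H,
        QuantumCorrelation.opCorrelation A B ρ =
          ρ.expectation (QuantumCorrelation.symmProduct A B),
      ∀ B : H →L[ℂ] H, IsSelfAdjoint B → spectrum ℂ B = {1, -1} →
        ∀ ρ : QuantumCorrelation.State H,
          QuantumCorrelation.opCorrelation A B ρ =
            ρ.expectation (QuantumCorrelation.symmProduct A B),
      ∃ α : ℝ, 0 < α ∧ spectrum ℂ A = {(α : ℂ), -(α : ℂ)}] := by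
  tfae_have 1 → 2 := fun h B _ _ ρ => h B ρ
  tfae_have 2 → 3 := QuantumCorrelation.spectrum_eq_pair_of_opCorrelation_eq hA hAc hA'
  tfae_have 3 → 1 := by
    rintro ⟨α, hα, hs⟩ B ρ
    exact QuantumCorrelation.opCorrelation_eq_of_spectrum_eq_pair hA hAc hα.ne' hs B ρ
  tfae_finish
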